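/- Let $(V,\|\cdot\|_V)$ be a real Banach space, let $T\in(0,\infty)$, and let $f\colon[0,T]\times V\to V$ be continuous and such that for every $t\in[0,T]$ the map $V\ni x\mapsto f(t,x)\in V$ is Fréchet differentiable and such that $[0,T]\times V\ni(t,x)\mapsto\frac{\partial}{\partial x}f(t,x)\in L(V)$ is continuous, where $L(V)$ is the space of bounded linear operators on $V$ with the operator norm. For every $x\in V$ and $s\in[0,T]$ let $X^x_{s,(\cdot)}\colon[s,T]\to V$ be a continuous function which satisfies for all $t\in[s,T]$ that $X^x_{s,t}=x+\int_s^t f(\tau,X^x_{s,\tau})\,d\tau$. Let $Y,E\colon[0,T]\to V$ be strongly measurable functions (pointwise limits of sequences of Borel measurable functions with finitely many values) which satisfy for all $t\in[0,T]$ that $\int_0^T[\|f(\tau,Y_\tau)\|_V+\|E_\tau\|_V]\,d\tau<\infty$ and $Y_t=Y_0+\int_0^t[f(\tau,Y_\tau)+E_\tau]\,d\tau$ (Bochner integrals). Then 1. for all $0\le s\le t\le T$ the map $V\ni x\mapsto X^x_{s,t}\in V$ is Fréchet differentiable, and the maps $(s,t,x)\mapsto X^x_{s,t}\in V$ and $(s,t,x)\mapsto\frac{\partial}{\partial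 x}X^x_{s,t}\in L(V)$ are continuous on $\{(s,t)\in[0,T]^2\colon s\le t\}\times V$; 2. the map $\{(s,t)\in(0,T)^2\colon s<t\}\times V\ni(s,t,x)\mapsto X^x_{s,t}\in V$ is continuously (Fréchet) differentiable; 3. for all $t\in[0,T]$ the function $[0,t]\ni\tau\mapsto\big(\frac{\partial}{\partial x}X^{Y_\tau}_{\tau,t}\big)E_\tau\in V$ is strongly measurable, where $\frac{\partial}{\partial x}X^{Y_\tau}_{\tau,t}$ is the derivative of $x\mapsto X^x_{\tau,t}$ at $x=Y_\tau$; 4. for all $t\in[0,T]$ it holds that $\int_0^t\big\|\big(\frac{\partial}{\partial x}X^{Y_\tau}_{\tau,t}\big)E_\tau\big\|_V\,d\tau<\infty$; 5. for all $s\in[0,T]$, $t\in[s,T]$ it holds that $$Y_t=X^{Y_s}_{s,t}+\int_s^t\Big(\frac{\partial}{\partial x}X^{Y_\tau}_{\tau,t}\Big)E_\tau\,d\tau.$$ -/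

import Mathlib

open Set MeasureTheory
open scoped ENNReal

open Filter Topology

/-! The formula in item 5 says that `H r = X r t (Y r) - ∫ τ in s..r, fderiv ℝ (X τ t) (Y τ) (E τ)`
is constant on `[s,t]`. By the flow property, `X r t (Y r) = X r' t (X r r' (Y r))`, so the
increment of `X · t (Y ·)` from `r` to `r'` compares one map, `X r' t`, at two nearby points, `Y r'`
and `X r r' (Y r)`. Their difference is the integral of `E` up to `o(r' - r)`, and the spatial
derivative of the flow, jointly continuous, turns it into the increment of the integral. As `E` is
only integrable, `H` is not differentiated: its right increments are shown to be negligible against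
those of `r + ∫ ‖E‖`, which forces constancy.

No derivative in the starting time enters. It comes out afterwards: the formula for the constant
path `Y = x` with `E = -F(·, x)` writes `X s t x` as an integral from `s`. With continuous partials
in all variables, joint differentiability follows.

The regularity in `x` rests on one Grönwall estimate, `norm_le_mul_exp_of_integral_approx`, applied
to differences of trajectories, to the remainder of their linearization, and to solutions of the
variational equation. -/

/-! ### Grönwall estimate, linear equations, tubes and a constancy criterion -/

/-- Grönwall with bootstrapping. The growth bound is known only while `w` stays in the ball of
radius `r`; since the resulting estimate is strictly below `r`, there is no first time at which `w`
leaves the ball. `D` is the defect in the integral equation, `η` a source term. -/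
theorem norm_le_mul_exp_of_integral_approx {W : Type*} [NormedAddCommGroup W] [NormedSpace ℝ W]
    {a b L r D η : ℝ} {w q : ℝ → W} (hab : a ≤ b) (hL : 0 ≤ L) (hη : 0 ≤ η)
    (hw : ContinuousOn w (Icc a b))
    (happrox : ∀ t ∈ Icc a b, ‖w t - ∫ τ in a..t, q τ‖ ≤ D)
    (hq : ∀ τ ∈ Icc a b, ‖w τ‖ < r → ‖q τ‖ ≤ L * ‖w τ‖ + η)
    (hr : (D + η * (b - a)) * Real.exp (L * (b - a)) < r) :
    ∀ t ∈ Icc a b, ‖w t‖ ≤ (D + η * (b - a)) * Real.exp (L * (b - a)) := by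
  have hD : 0 ≤ D := (norm_nonneg _).trans (happrox a (left_mem_Icc.2 hab))
  set K := D + η * (b - a) with hK
  have hK0 : 0 ≤ K := add_nonneg hD (mul_nonneg hη (sub_nonneg.2 hab))
  -- Extended continuously to all of `ℝ`, so that its primitive is differentiable everywhere,
  -- endpoints included.
  set g : ℝ → ℝ := fun s => ‖w (projIcc a b hab s)‖ with hg
  have hgc : Continuous g := by
    have := (continuousOn_iff_continuous_domRestrict.1 hw).comp (continuous_projIcc (h := hab))
    exact this.norm
  have hgw : ∀ s ∈ Icc a b, g s = ‖w s‖ := fun s hs => by simp [hg, projIcc_of_mem hab hs]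
  have hgi : ∀ c d, IntervalIntegrable g volume c d := fun c d => hgc.intervalIntegrable c d
  have stepA : ∀ t ∈ Icc a b, (∀ τ ∈ Ico a t, ‖w τ‖ < r) → ‖w t‖ ≤ K + L * ∫ τ in a..t, g τ := by
    intro t ht hlt
    have h1 : ‖∫ τ in a..t, q τ‖ ≤ ∫ τ in a..t, (L * g τ + η) := by
      refine intervalIntegral.norm_integral_le_of_norm_le ht.1 ?_
        (((hgi a t).const_mul L).add intervalIntegrable_const)
      -- The endpoint `t`, where the bound by `r` is not yet known, is a null set.
      filter_upwards [(countable_singleton t).ae_notMem volume] with τ hτ hτ'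
      have hmem : τ ∈ Icc a b := ⟨hτ'.1.le, hτ'.2.trans ht.2⟩
      rw [hgw τ hmem]
      exact hq τ hmem (hlt τ ⟨hτ'.1.le, lt_of_le_of_ne hτ'.2 hτ⟩)
    have h2 : ∫ τ in a..t, (L * g τ + η) = L * (∫ τ in a..t, g τ) + η * (t - a) := by
      rw [intervalIntegral.integral_add ((hgi a t).const_mul L) intervalIntegrable_const,
        intervalIntegral.integral_const_mul]
      simp [mul_comm]
    have h3 : ‖w t‖ ≤ ‖w t - ∫ τ in a..t, q τ‖ + ‖∫ τ in a..t, q τ‖ := by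
      simpa using norm_add_le (w t - ∫ τ in a..t, q τ) (∫ τ in a..t, q τ)
    have h4 := happrox t ht
    have h5 : η * (t - a) ≤ η * (b - a) := by gcongr; exact ht.2
    linarith
  have stepB : ∀ t ∈ Icc a b, (∀ τ ∈ Ico a t, ‖w τ‖ < r) → ‖w t‖ ≤ K * Real.exp (L * (b - a)) := by
    intro t ht hlt
    have hder : ∀ s, HasDerivAt (fun s => K + L * ∫ τ in a..s, g τ) (L * g s) s := fun s =>
      ((intervalIntegral.integral_hasDerivAt_right (hgi a s)
        hgc.stronglyMeasurable.stronglyMeasurableAtFilter hgc.continuousAt).const_mul L).const_add K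
    have hgr := le_gronwallBound_of_liminf_deriv_right_le (δ := K) (K := L) (ε := 0)
      (f := fun s => K + L * ∫ τ in a..s, g τ) (f' := fun s => L * g s) (a := a) (b := t)
      (fun s _ => (hder s).continuousAt.continuousWithinAt)
      (fun s _ r hr => (hder s).hasDerivWithinAt.liminf_right_slope_le hr) (by simp)
      (fun s hs => by
        have hs' : s ∈ Icc a b := ⟨hs.1, hs.2.le.trans ht.2⟩
        rw [add_zero]
        gcongr
        rw [hgw s hs']
        exact stepA s hs' fun τ hτ => hlt τ ⟨hτ.1, hτ.2.trans hs.2⟩) t ⟨ht.1, le_rfl⟩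
    rw [gronwallBound_ε0] at hgr
    refine (stepA t ht hlt).trans (hgr.trans ?_)
    gcongr
    exact ht.2
  have hall : ∀ t ∈ Icc a b, ‖w t‖ < r := by
    by_contra! hcon
    obtain ⟨t₀, ht₀, hrt₀⟩ := hcon
    have hcl : IsCompact (Icc a b ∩ (fun t => ‖w t‖) ⁻¹' Ici r) :=
      isCompact_Icc.of_isClosed_subset (hw.norm.preimage_isClosed_of_isClosed isClosed_Icc isClosed_Ici)
        inter_subset_left
    obtain ⟨t₁, ⟨ht₁, hrt₁⟩, hmin⟩ := hcl.exists_isLeast ⟨t₀, ht₀, hrt₀⟩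
    have := stepB t₁ ht₁ fun τ hτ => by
      by_contra! h
      exact absurd (hmin ⟨⟨hτ.1, hτ.2.le.trans ht₁.2⟩, h⟩) (not_le.2 hτ.2)
    exact absurd hr (not_lt.2 (le_trans hrt₁ this))
  exact fun t ht => stepB t ht fun τ hτ => hall τ ⟨hτ.1, hτ.2.le.trans ht.2⟩

theorem exists_linear_integral_solution {W : Type*} [NormedAddCommGroup W] [NormedSpace ℝ W]
    [CompleteSpace W] {a b : ℝ} {A : ℝ → W →L[ℝ] W} (hA : Continuous A) (w₀ : W) :
    ∃ u : ℝ → W, ContinuousOn u (Icc a b) ∧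
      ∀ t ∈ Icc a b, u t = w₀ + ∫ τ in a..t, A τ (u τ) := by
  obtain ⟨M, hM⟩ := isCompact_Icc.exists_bound_of_continuousOn (s := Icc a b) hA.continuousOn
  -- The increments of the Picard iteration; the solution is their sum, dominated by an exponential
  -- series.
  let J : ℕ → ℝ → W := fun n => n.rec (fun _ => w₀) fun _ Jn t => ∫ τ in a..t, A τ (Jn τ)
  have hJs : ∀ n t, J (n + 1) t = ∫ τ in a..t, A τ (J n τ) := fun _ _ => rfl
  have hJc : ∀ n, Continuous (J n) := by
    intro n
    induction n with
    | zero => exact continuous_const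
    | succ n ih =>
      exact intervalIntegral.continuous_primitive
        (fun c d => (hA.clm_apply ih).intervalIntegrable c d) a
  have hJb : ∀ n, ∀ t ∈ Icc a b, ‖J n t‖ ≤ ‖w₀‖ * (M ^ n * (t - a) ^ n / n.factorial) := by
    intro n
    induction n with
    | zero => intro t _; simp [J]
    | succ n ih =>
      intro t ht
      have hM0 : 0 ≤ M := (norm_nonneg _).trans (hM t ht)
      rw [hJs]
      have h1 : ‖∫ τ in a..t, A τ (J n τ)‖ ≤
          ∫ τ in a..t, M * (‖w₀‖ * (M ^ n * (τ - a) ^ n / n.factorial)) := by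
        refine intervalIntegral.norm_integral_le_of_norm_le ht.1 (ae_of_all _ fun τ hτ => ?_)
          (Continuous.intervalIntegrable (by fun_prop) _ _)
        have hτ' : τ ∈ Icc a b := ⟨hτ.1.le, hτ.2.trans ht.2⟩
        refine (ContinuousLinearMap.le_opNorm _ _).trans ?_
        gcongr
        · exact hM τ hτ'
        · exact ih τ hτ'
      refine h1.trans (le_of_eq ?_)
      have h2 : (fun τ : ℝ => M * (‖w₀‖ * (M ^ n * (τ - a) ^ n / n.factorial))) =
          fun τ => (M ^ (n + 1) * ‖w₀‖ / n.factorial) * (τ - a) ^ n := by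
        ext τ; ring
      rw [h2, intervalIntegral.integral_const_mul,
        intervalIntegral.integral_comp_sub_right (fun x => x ^ n) a, integral_pow,
        Nat.factorial_succ]
      have : (n.factorial : ℝ) ≠ 0 := by positivity
      push_cast
      field_simp
      simp
  have hsum : Summable fun n : ℕ => ‖w₀‖ * ((M * (b - a)) ^ n / n.factorial) :=
    (Real.summable_pow_div_factorial _).mul_left _
  have hJb' : ∀ n, ∀ t ∈ Icc a b, ‖J n t‖ ≤ ‖w₀‖ * ((M * (b - a)) ^ n / n.factorial) := by
    intro n t ht
    have hM0 : 0 ≤ M := (norm_nonneg _).trans (hM t ht)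
    refine (hJb n t ht).trans ?_
    rw [mul_pow]
    have := sub_nonneg.2 ht.1
    gcongr
    exact ht.2
  have hJsum : ∀ t ∈ Icc a b, Summable fun n => J n t := fun t ht =>
    Summable.of_norm_bounded hsum fun n => hJb' n t ht
  refine ⟨fun t => ∑' n, J n t, continuousOn_tsum (fun n => (hJc n).continuousOn) hsum hJb',
    fun t ht => ?_⟩
  have hint : HasSum (fun n => ∫ τ in a..t, A τ (J n τ)) (∫ τ in a..t, A τ (∑' n, J n τ)) := by
    refine intervalIntegral.hasSum_integral_of_dominated_convergence
      (fun n _ => M * (‖w₀‖ * ((M * (b - a)) ^ n / n.factorial)))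
      (fun n => (hA.clm_apply (hJc n)).aestronglyMeasurable) (fun n => ae_of_all _ fun τ hτ => ?_)
      (ae_of_all _ fun τ _ => hsum.mul_left M) intervalIntegrable_const
      (ae_of_all _ fun τ hτ => ?_)
    all_goals
      rw [uIoc_of_le ht.1] at hτ
      have hτ' : τ ∈ Icc a b := ⟨hτ.1.le, hτ.2.trans ht.2⟩
    · have hM0 : 0 ≤ M := (norm_nonneg _).trans (hM t ht)
      refine (ContinuousLinearMap.le_opNorm _ _).trans ?_
      gcongr
      · exact hM τ hτ'
      · exact hJb' n τ hτ'
    · exact (A τ).hasSum (hJsum τ hτ').hasSum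
  beta_reduce
  rw [(hJsum t ht).tsum_eq_zero_add]
  simp only [hJs]
  rw [hint.tsum_eq]
  rfl

theorem Continuous.exists_uniform_tube {V W : Type*} [NormedAddCommGroup V] [NormedAddCommGroup W]
    {Φ : ℝ × V → W} (hΦ : Continuous Φ) {K : Set ℝ} (hK : IsCompact K) {γ : ℝ → V}
    (hγ : ContinuousOn γ K) {ε : ℝ} (hε : 0 < ε) :
    ∃ δ > 0, ∀ τ ∈ K, ∀ y, ‖y - γ τ‖ < δ → ‖Φ (τ, y) - Φ (τ, γ τ)‖ < ε := by
  have hc : IsCompact ((fun τ => (τ, γ τ)) '' K) := hK.image_of_continuousOn (by fun_prop)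
  have := hc.uniformContinuousAt_of_continuousAt Φ (fun p _ => hΦ.continuousAt)
    (Metric.dist_mem_uniformity hε)
  obtain ⟨δ, hδ, h⟩ := Metric.mem_uniformity_dist.1 this
  refine ⟨δ, hδ, fun τ hτ y hy => ?_⟩
  have h1 : dist (τ, γ τ) (τ, y) < δ := by
    rw [Prod.dist_eq, dist_self, dist_comm (γ τ), dist_eq_norm]
    exact max_lt hδ hy
  have h2 := h h1 ⟨τ, hτ, rfl⟩
  rwa [mem_ofPred_eq, dist_comm, dist_eq_norm] at h2

/-- Replaces "zero derivative implies constant" when increments are compared with those of a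
continuous `m` instead of with time. Continuous induction along `[a,b]` gives a bound by `ε * (m b -
m a)`; then `ε → 0`. -/
theorem eq_of_forall_eventually_norm_sub_le {W : Type*} [NormedAddCommGroup W] {a b : ℝ}
    (hab : a ≤ b) {H : ℝ → W} {m : ℝ → ℝ} (hH : ContinuousOn H (Icc a b))
    (hm : ContinuousOn m (Icc a b))
    (h : ∀ s ∈ Ico a b, ∀ ε > 0, ∀ᶠ s' in 𝓝[>] s, ‖H s' - H s‖ ≤ ε * (m s' - m s)) :
    H b = H a := by
  have key : ∀ ε > 0, ‖H b - H a‖ ≤ ε * (m b - m a) := by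
    intro ε hε
    have hsub : Icc a b ⊆ {t | ‖H t - H a‖ ≤ ε * (m t - m a)} := by
      refine IsClosed.Icc_subset_of_forall_exists_gt ?_ (by simp) ?_
      · rw [inter_comm]
        exact isClosed_Icc.isClosed_le (hH.sub continuousOn_const).norm
          (continuousOn_const.mul (hm.sub continuousOn_const))
      · rintro s ⟨hs, hsab⟩ y hy
        obtain ⟨z, hz, hz'⟩ := ((h s hsab ε hε).and (Ioc_mem_nhdsGT hy)).exists
        refine ⟨z, ?_, hz'⟩
        have : ‖H z - H a‖ ≤ ‖H z - H s‖ + ‖H s - H a‖ := norm_sub_le_norm_sub_add_norm_sub ..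
        simp only [mem_ofPred_eq] at hs ⊢
        linarith
    exact hsub (right_mem_Icc.2 hab)
  have hlim : Tendsto (fun ε : ℝ => ε * (m b - m a)) (𝓝[>] 0) (𝓝 0) := by
    have : Tendsto (fun ε : ℝ => ε * (m b - m a)) (𝓝 0) (𝓝 (0 * (m b - m a))) :=
      tendsto_id.mul_const _
    rw [zero_mul] at this
    exact this.mono_left nhdsWithin_le_nhds
  have : ‖H b - H a‖ ≤ 0 := ge_of_tendsto hlim (eventually_mem_nhdsWithin.mono key)
  exact sub_eq_zero.1 (norm_le_zero_iff.1 this)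

/-! ### Flows: uniqueness, flow property, joint continuity -/

/-- `X s t x` is, for `0 ≤ s ≤ t ≤ T`, the value at time `t` of a solution of `u' = F t u`
started from `x` at time `s`, where `F` is continuous, with a continuous derivative in space. -/
structure IsC1Flow {V : Type*} [NormedAddCommGroup V] [NormedSpace ℝ V] (T : ℝ)
    (F : ℝ → V → V) (X : ℝ → ℝ → V → V) : Prop where
  cont : Continuous fun p : ℝ × V => F p.1 p.2
  diff : ∀ t, Differentiable ℝ (F t)
  cont_fderiv : Continuous fun p : ℝ × V => fderiv ℝ (F p.1) p.2
  flow_cont : ∀ x, ∀ s ∈ Icc 0 T, ContinuousOn (fun t => X s t x) (Icc s T)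
  flow_eq : ∀ x, ∀ s ∈ Icc 0 T, ∀ t ∈ Icc s T, X s t x = x + ∫ τ in s..t, F τ (X s τ x)

theorem continuousOn_comp_max {W : Type*} [TopologicalSpace W] {s T : ℝ} (hs : s ∈ Icc 0 T)
    {u : ℝ → W} (hu : ContinuousOn u (Icc s T)) :
    ContinuousOn (fun t => u (max s t)) (Icc 0 T) :=
  hu.comp (by fun_prop) fun _ ht => ⟨le_max_left .., max_le hs.2 ht.2⟩

/-- Trajectories with different starting times need a common time interval. Freezing `u` at `u s`
before time `s` makes it an approximate solution from any `σ`; the defect is an integral of `p` over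
a subinterval between `s` and `σ`. -/
theorem norm_comp_max_sub_integral_le {W : Type*} [NormedAddCommGroup W] [NormedSpace ℝ W]
    {s σ t T M : ℝ} (hs : s ∈ Icc 0 T) (hσ : σ ∈ Icc 0 T) (ht : t ∈ Icc σ T) {u p : ℝ → W} {x : W}
    (hp : ContinuousOn p (Icc 0 T)) (hM : ∀ τ ∈ Icc 0 T, ‖p τ‖ ≤ M)
    (hu : ∀ t ∈ Icc s T, u t = x + ∫ τ in s..t, p τ) :
    ‖u (max s t) - x - ∫ τ in σ..t, p τ‖ ≤ M * |σ - s| := by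
  have hi : ∀ c ∈ Icc 0 T, ∀ d ∈ Icc 0 T, IntervalIntegrable p volume c d := fun c hc d hd =>
    (hp.mono (uIcc_subset_Icc hc hd)).intervalIntegrable
  have hb : ∀ c ∈ Icc 0 T, ∀ d ∈ Icc 0 T, ‖∫ τ in c..d, p τ‖ ≤ M * |d - c| := fun c hc d hd =>
    intervalIntegral.norm_integral_le_of_norm_le_const fun τ hτ =>
      hM τ (uIcc_subset_Icc hc hd (uIoc_subset_uIcc hτ))
  have ht0 : t ∈ Icc 0 T := ⟨hσ.1.trans ht.1, ht.2⟩
  have hM0 : 0 ≤ M := (norm_nonneg _).trans (hM s hs)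
  rcases le_total s t with hst | hst
  · rw [max_eq_right hst, hu t ⟨hst, ht.2⟩, add_sub_cancel_left,
      ← intervalIntegral.integral_add_adjacent_intervals (hi s hs σ hσ) (hi σ hσ t ht0),
      add_sub_cancel_right]
    exact hb s hs σ hσ
  · rw [max_eq_left hst, hu s ⟨le_rfl, hs.2⟩, intervalIntegral.integral_same, add_zero, sub_self,
      zero_sub, norm_neg]
    refine (hb σ hσ t ht0).trans ?_
    rw [abs_of_nonneg (sub_nonneg.2 ht.1), abs_sub_comm, abs_of_nonneg (by linarith [ht.1])]
    gcongr

theorem continuousWithinAt_of_eventually_norm_sub_lt {V W : Type*} [NormedAddCommGroup V]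
    [NormedAddCommGroup W] {T s₀ t₀ : ℝ} {x₀ : V} {G : ℝ → ℝ → V → W} {γ : ℝ → W}
    (hγ : ContinuousOn γ (Icc 0 T)) (ht₀ : t₀ ∈ Icc 0 T) (hγ₀ : γ t₀ = G s₀ t₀ x₀)
    (h : ∀ ε > 0, ∀ᶠ p in 𝓝 (s₀, x₀), p.1 ∈ Icc 0 T → ∀ t ∈ Icc p.1 T, ‖G p.1 t p.2 - γ t‖ < ε) :
    ContinuousWithinAt (fun p : ℝ × ℝ × V => G p.1 p.2.1 p.2.2)
      {p | 0 ≤ p.1 ∧ p.1 ≤ p.2.1 ∧ p.2.1 ≤ T} (s₀, t₀, x₀) := by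
  rw [ContinuousWithinAt, Metric.tendsto_nhds]
  intro ε hε
  have h1 : Tendsto (fun p : ℝ × ℝ × V => (p.1, p.2.2))
      (𝓝[{p | 0 ≤ p.1 ∧ p.1 ≤ p.2.1 ∧ p.2.1 ≤ T}] (s₀, t₀, x₀)) (𝓝 (s₀, x₀)) :=
    (Continuous.tendsto (by fun_prop) _).mono_left nhdsWithin_le_nhds
  have h2 : ContinuousWithinAt (fun p : ℝ × ℝ × V => γ p.2.1)
      {p | 0 ≤ p.1 ∧ p.1 ≤ p.2.1 ∧ p.2.1 ≤ T} (s₀, t₀, x₀) :=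
    ContinuousWithinAt.comp (t := Icc 0 T) (f := fun p : ℝ × ℝ × V => p.2.1) (x := (s₀, t₀, x₀))
      (hγ t₀ ht₀)
      (Continuous.continuousWithinAt (by fun_prop)) fun p hp => ⟨hp.1.trans hp.2.1, hp.2.2⟩
  filter_upwards [h1.eventually (h (ε / 2) (half_pos hε)),
    Metric.tendsto_nhds.1 h2 (ε / 2) (half_pos hε), self_mem_nhdsWithin] with p hp1 hp2 hp
  have h3 := hp1 ⟨hp.1, hp.2.1.trans hp.2.2⟩ p.2.1 hp.2
  rw [← dist_eq_norm] at h3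
  have h4 := dist_triangle (G p.1 p.2.1 p.2.2) (γ p.2.1) (γ t₀)
  rw [← hγ₀]
  linarith

namespace IsC1Flow

variable {V : Type*} [NormedAddCommGroup V] [NormedSpace ℝ V] {T : ℝ} {F : ℝ → V → V}
  {X : ℝ → ℝ → V → V}

theorem exists_linearization (hX : IsC1Flow T F X) {K : Set ℝ} (hK : IsCompact K) {γ : ℝ → V}
    (hγ : ContinuousOn γ K) {ε : ℝ} (hε : 0 < ε) :
    ∃ δ > 0, ∀ τ ∈ K, ∀ y, ‖y - γ τ‖ < δ →
      ‖F τ y - F τ (γ τ) - fderiv ℝ (F τ) (γ τ) (y - γ τ)‖ ≤ ε * ‖y - γ τ‖ := by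
  obtain ⟨δ, hδ, h⟩ := hX.cont_fderiv.exists_uniform_tube hK hγ hε
  refine ⟨δ, hδ, fun τ hτ y hy => ?_⟩
  refine (convex_ball (γ τ) δ).norm_image_sub_le_of_norm_fderiv_le' (𝕜 := ℝ)
    (fun z _ => hX.diff τ z) (fun z hz => (h τ hτ z (by simpa [dist_eq_norm] using hz)).le)
    (Metric.mem_ball_self hδ) (by simpa [dist_eq_norm] using hy)

theorem continuousOn_fderiv_comp (hX : IsC1Flow T F X) {K : Set ℝ} {γ : ℝ → V}
    (hγ : ContinuousOn γ K) : ContinuousOn (fun τ => fderiv ℝ (F τ) (γ τ)) K :=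
  hX.cont_fderiv.comp_continuousOn (f := fun τ => (τ, γ τ)) (by fun_prop)

theorem continuousOn_comp (hX : IsC1Flow T F X) {K : Set ℝ} {γ : ℝ → V}
    (hγ : ContinuousOn γ K) : ContinuousOn (fun τ => F τ (γ τ)) K :=
  hX.cont.comp_continuousOn (f := fun τ => (τ, γ τ)) (by fun_prop)

theorem exists_lipschitz (hX : IsC1Flow T F X) {K : Set ℝ} (hK : IsCompact K) {γ : ℝ → V}
    (hγ : ContinuousOn γ K) :
    ∃ r > 0, ∃ L ≥ 0, ∀ τ ∈ K, ∀ y, ‖y - γ τ‖ < r →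
      ‖F τ y - F τ (γ τ)‖ ≤ L * ‖y - γ τ‖ := by
  obtain ⟨r, hr, h⟩ := hX.exists_linearization hK hγ one_pos
  obtain ⟨M, hM⟩ := hK.exists_bound_of_continuousOn (hX.continuousOn_fderiv_comp hγ)
  refine ⟨r, hr, |M| + 1, by positivity, fun τ hτ y hy => ?_⟩
  have h1 := h τ hτ y hy
  have h2 : ‖fderiv ℝ (F τ) (γ τ) (y - γ τ)‖ ≤ |M| * ‖y - γ τ‖ :=
    (ContinuousLinearMap.le_opNorm _ _).trans (by gcongr; exact (hM τ hτ).trans (le_abs_self M))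
  have h3 := norm_add_le (F τ y - F τ (γ τ) - fderiv ℝ (F τ) (γ τ) (y - γ τ))
    (fderiv ℝ (F τ) (γ τ) (y - γ τ))
  rw [sub_add_cancel] at h3
  linarith

theorem flow_self (hX : IsC1Flow T F X) {s : ℝ} (hs : s ∈ Icc 0 T) (x : V) : X s s x = x := by
  simpa using hX.flow_eq x s hs s ⟨le_rfl, hs.2⟩

/-- A Lipschitz bound in a tube around `v` suffices: with zero defect the Grönwall bound is `0 < r`,
so `u` never leaves the tube. -/
theorem eqOn_of_integral_eq (hX : IsC1Flow T F X) {a b : ℝ} (hab : a ≤ b) {u v : ℝ → V} {x : V}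
    (hu : ContinuousOn u (Icc a b)) (hv : ContinuousOn v (Icc a b))
    (hue : ∀ t ∈ Icc a b, u t = x + ∫ τ in a..t, F τ (u τ))
    (hve : ∀ t ∈ Icc a b, v t = x + ∫ τ in a..t, F τ (v τ)) : EqOn u v (Icc a b) := by
  obtain ⟨r, hr, L, hL, hlip⟩ := hX.exists_lipschitz isCompact_Icc hv
  intro t ht
  have key := norm_le_mul_exp_of_integral_approx (D := 0) (η := 0) (r := r)
    (w := fun t => u t - v t) (q := fun τ => F τ (u τ) - F τ (v τ)) hab hL le_rfl (hu.sub hv)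
    (fun t ht => by
      have hi : ∀ {w : ℝ → V}, ContinuousOn w (Icc a b) →
          IntervalIntegrable (fun τ => F τ (w τ)) volume a t := fun hw =>
        ((hX.continuousOn_comp hw).mono (Icc_subset_Icc_right ht.2)).intervalIntegrable_of_Icc ht.1
      rw [intervalIntegral.integral_sub (hi hu) (hi hv), hue t ht, hve t ht]
      simp)
    (fun τ hτ h => by simpa using hlip τ hτ (u τ) h) (by simpa using hr) t ht
  simpa [sub_eq_zero] using key

theorem flow_comp (hX : IsC1Flow T F X) {s r t : ℝ} (hs : 0 ≤ s) (hsr : s ≤ r) (hrt : r ≤ t)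
    (ht : t ≤ T) (x : V) : X r t (X s r x) = X s t x := by
  have hs' : s ∈ Icc 0 T := ⟨hs, hsr.trans (hrt.trans ht)⟩
  have hr' : r ∈ Icc 0 T := ⟨hs.trans hsr, hrt.trans ht⟩
  have hsub : Icc r T ⊆ Icc s T := Icc_subset_Icc_left hsr
  refine hX.eqOn_of_integral_eq hr'.2 (hX.flow_cont _ r hr') ((hX.flow_cont x s hs').mono hsub)
    (hX.flow_eq _ r hr') (fun t ht => ?_) ⟨hrt, ht⟩
  have hc := hX.continuousOn_comp (hX.flow_cont x s hs')
  rw [hX.flow_eq x s hs' t (hsub ht), hX.flow_eq x s hs' r ⟨hsr, hr'.2⟩, add_assoc,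
    intervalIntegral.integral_add_adjacent_intervals]
  · exact (hc.mono (Icc_subset_Icc_right hr'.2)).intervalIntegrable_of_Icc hsr
  · exact (hc.mono (Icc_subset_Icc hsr ht.2)).intervalIntegrable_of_Icc ht.1

theorem exists_eventually_norm_flow_sub_le (hX : IsC1Flow T F X) {s₀ : ℝ} (hs₀ : s₀ ∈ Icc 0 T)
    (x₀ : V) : ∃ C ≥ 0, ∀ᶠ p in 𝓝 (s₀, x₀), p.1 ∈ Icc 0 T → ∀ t ∈ Icc p.1 T,
      ‖X p.1 t p.2 - X s₀ (max s₀ t) x₀‖ ≤ C * (‖p.2 - x₀‖ + |p.1 - s₀|) := by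
  set γ : ℝ → V := fun t => X s₀ (max s₀ t) x₀ with hγ
  have hγc : ContinuousOn γ (Icc 0 T) := continuousOn_comp_max hs₀ (hX.flow_cont x₀ s₀ hs₀)
  obtain ⟨r, hr, L, hL, hlip⟩ := hX.exists_lipschitz isCompact_Icc hγc
  have hpc := hX.continuousOn_comp hγc
  obtain ⟨M, hM⟩ := isCompact_Icc.exists_bound_of_continuousOn hpc
  have hM0 : 0 ≤ M := (norm_nonneg _).trans (hM s₀ hs₀)
  -- The `1` accounts for the change of initial value, `M` for the shift of starting time.
  set C := (1 + M) * Real.exp (L * T) with hC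
  have hC0 : 0 ≤ C := by positivity
  have hev : ∀ᶠ p : ℝ × V in 𝓝 (s₀, x₀), C * (‖p.2 - x₀‖ + |p.1 - s₀|) < r := by
    have : Continuous fun p : ℝ × V => C * (‖p.2 - x₀‖ + |p.1 - s₀|) := by fun_prop
    exact this.continuousAt.eventually_lt continuousAt_const (by simpa using hr)
  refine ⟨C, hC0, hev.mono fun p hp hs t ht => ?_⟩
  obtain ⟨s, x⟩ := p
  simp only at hp hs ht ⊢
  have hsub : Icc s T ⊆ Icc 0 T := Icc_subset_Icc_left hs.1
  have hbound : (‖x - x₀‖ + M * |s - s₀| + 0 * (T - s)) * Real.exp (L * (T - s)) ≤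
      C * (‖x - x₀‖ + |s - s₀|) := by
    have h1 : Real.exp (L * (T - s)) ≤ Real.exp (L * T) := by
      gcongr; linarith [hs.1]
    calc _ ≤ ((1 + M) * (‖x - x₀‖ + |s - s₀|)) * Real.exp (L * T) := by
          gcongr
          nlinarith [norm_nonneg (x - x₀), abs_nonneg (s - s₀)]
      _ = _ := by rw [hC]; ring
  refine (norm_le_mul_exp_of_integral_approx (D := ‖x - x₀‖ + M * |s - s₀|) (η := 0) (r := r)
    (w := fun t => X s t x - γ t) (q := fun τ => F τ (X s τ x) - F τ (γ τ)) hs.2 hL le_rfl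
    ((hX.flow_cont x s hs).sub (hγc.mono hsub)) (fun t ht => ?_)
    (fun τ hτ h => by simpa using hlip τ (hsub hτ) _ h) (hbound.trans_lt hp) t ht).trans hbound
  have h1 := norm_comp_max_sub_integral_le hs₀ hs ht hpc hM
    (u := fun t => X s₀ t x₀) (x := x₀) (fun t ht => by
      rw [hX.flow_eq x₀ s₀ hs₀ t ht]
      congr 1
      refine intervalIntegral.integral_congr fun τ hτ => ?_
      rw [uIcc_of_le ht.1] at hτ
      simp [hγ, max_eq_right hτ.1])
  have hst : Icc s t ⊆ Icc s T := Icc_subset_Icc_right ht.2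
  rw [intervalIntegral.integral_sub
    (((hX.continuousOn_comp (hX.flow_cont x s hs)).mono hst).intervalIntegrable_of_Icc ht.1)
    ((hpc.mono (hst.trans hsub)).intervalIntegrable_of_Icc ht.1), hX.flow_eq x s hs t ht]
  have h2 : x + (∫ τ in s..t, F τ (X s τ x)) - γ t -
      ((∫ τ in s..t, F τ (X s τ x)) - ∫ τ in s..t, F τ (γ τ)) =
      (x - x₀) - (γ t - x₀ - ∫ τ in s..t, F τ (γ τ)) := by abel
  rw [h2]
  exact (norm_sub_le _ _).trans (by gcongr)

theorem eventually_norm_flow_sub_lt (hX : IsC1Flow T F X) {s₀ : ℝ} (hs₀ : s₀ ∈ Icc 0 T)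
    (x₀ : V) {ε : ℝ} (hε : 0 < ε) : ∀ᶠ p in 𝓝 (s₀, x₀), p.1 ∈ Icc 0 T → ∀ t ∈ Icc p.1 T,
      ‖X p.1 t p.2 - X s₀ (max s₀ t) x₀‖ < ε := by
  obtain ⟨C, _, h⟩ := hX.exists_eventually_norm_flow_sub_le hs₀ x₀
  have hev : ∀ᶠ p : ℝ × V in 𝓝 (s₀, x₀), C * (‖p.2 - x₀‖ + |p.1 - s₀|) < ε := by
    have : Continuous fun p : ℝ × V => C * (‖p.2 - x₀‖ + |p.1 - s₀|) := by fun_prop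
    exact this.continuousAt.eventually_lt continuousAt_const (by simpa using hε)
  filter_upwards [h, hev] with p hp hp' hs t ht using (hp hs t ht).trans_lt hp'

theorem continuousOn_flow (hX : IsC1Flow T F X) :
    ContinuousOn (fun p : ℝ × ℝ × V => X p.1 p.2.1 p.2.2)
      {p | 0 ≤ p.1 ∧ p.1 ≤ p.2.1 ∧ p.2.1 ≤ T} := by
  rintro ⟨s₀, t₀, x₀⟩ ⟨h0, h1, h2⟩
  simp only at h0 h1 h2
  have hs₀ : s₀ ∈ Icc 0 T := ⟨h0, h1.trans h2⟩
  exact continuousWithinAt_of_eventually_norm_sub_lt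
    (continuousOn_comp_max hs₀ (hX.flow_cont x₀ s₀ hs₀)) ⟨h0.trans h1, h2⟩
    (by rw [max_eq_right h1]) fun ε hε => hX.eventually_norm_flow_sub_lt hs₀ x₀ hε

/-! ### Differentiability in the initial value -/

variable [CompleteSpace V]

/-- The candidate derivative solves the variational equation. The remainder `X s t (x + h) - X s t x
- J t h` solves the same linear equation with a source that is `o(‖h‖)` uniformly in time, by
Lipschitz dependence on `x`; Grönwall passes this on to the remainder. -/
theorem exists_hasFDerivAt (hX : IsC1Flow T F X) {s : ℝ} (hs : s ∈ Icc 0 T) (x : V) :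
    ∃ J : ℝ → V →L[ℝ] V, ContinuousOn J (Icc s T) ∧
      (∀ t ∈ Icc s T, J t = ContinuousLinearMap.id ℝ V +
        ∫ τ in s..t, (fderiv ℝ (F τ) (X s τ x)).comp (J τ)) ∧
      ∀ t ∈ Icc s T, HasFDerivAt (X s t) (J t) x := by
  have hγ := hX.flow_cont x s hs
  have hA := hX.continuousOn_fderiv_comp hγ
  -- The variational equation is a linear equation in the Banach space `V →L[ℝ] V`, with left
  -- composition as coefficient.
  have hA' : Continuous fun τ => ContinuousLinearMap.compL ℝ V V V
      (fderiv ℝ (F (projIcc s T hs.2 τ)) (X s (projIcc s T hs.2 τ) x)) :=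
    (ContinuousLinearMap.continuous _).comp
      ((continuousOn_iff_continuous_domRestrict.1 hA).comp (continuous_projIcc (h := hs.2)))
  obtain ⟨J, hJc, hJ⟩ := exists_linear_integral_solution (a := s) (b := T) hA'
    (ContinuousLinearMap.id ℝ V)
  have hJ' : ∀ t ∈ Icc s T, J t = ContinuousLinearMap.id ℝ V +
        ∫ τ in s..t, (fderiv ℝ (F τ) (X s τ x)).comp (J τ) := by
    intro t ht
    rw [hJ t ht]
    congr 1
    refine intervalIntegral.integral_congr fun τ hτ => ?_
    rw [uIcc_of_le ht.1] at hτ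
    simp [projIcc_of_mem hs.2 ⟨hτ.1, hτ.2.trans ht.2⟩]
  refine ⟨J, hJc, hJ', fun t ht => ?_⟩
  obtain ⟨M, hM⟩ := isCompact_Icc.exists_bound_of_continuousOn hA
  have hM0 : 0 ≤ M := (norm_nonneg _).trans (hM s ⟨le_rfl, hs.2⟩)
  obtain ⟨C, hC, hev⟩ := hX.exists_eventually_norm_flow_sub_le hs x
  have hev' : ∀ᶠ h : V in 𝓝 0, ∀ t ∈ Icc s T, ‖X s t (x + h) - X s t x‖ ≤ C * ‖h‖ := by
    have ht : Tendsto (fun h : V => (s, x + h)) (𝓝 0) (𝓝 (s, x)) := by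
      have : Continuous fun h : V => (s, x + h) := by fun_prop
      simpa using this.tendsto 0
    filter_upwards [ht.eventually hev] with h hh t ht
    simpa [max_eq_right ht.1] using hh hs t ht
  rw [hasFDerivAt_iff_isLittleO_nhds_zero, Asymptotics.isLittleO_iff]
  intro c hc
  set R := C * (T - s) * Real.exp (M * (T - s)) with hR
  have hTs : 0 ≤ T - s := sub_nonneg.2 hs.2
  have hR0 : 0 ≤ R := by positivity
  set ε := c / (R + 1) with hε
  have hε0 : 0 < ε := by positivity
  have hεR : ε * R ≤ c := by
    rw [hε, div_mul_eq_mul_div, div_le_iff₀ (by positivity)]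
    nlinarith
  obtain ⟨δ, hδ, hlin⟩ := hX.exists_linearization isCompact_Icc hγ hε0
  have hsmall : ∀ᶠ h : V in 𝓝 0, C * ‖h‖ < δ := by
    have : Continuous fun h : V => C * ‖h‖ := by fun_prop
    exact this.continuousAt.eventually_lt continuousAt_const (by simpa using hδ)
  filter_upwards [hev', hsmall] with h hh hhδ
  have key := norm_le_mul_exp_of_integral_approx (D := 0) (η := ε * (C * ‖h‖)) (L := M)
    -- No bootstrapping is needed here: the growth bound holds unconditionally, so any `r` above the
    -- estimate will do.
    (r := (0 + ε * (C * ‖h‖) * (T - s)) * Real.exp (M * (T - s)) + 1)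
    (w := fun t => X s t (x + h) - X s t x - J t h)
    (q := fun τ => F τ (X s τ (x + h)) - F τ (X s τ x) - fderiv ℝ (F τ) (X s τ x) (J τ h))
    hs.2 hM0 (by positivity)
    (((hX.flow_cont _ s hs).sub hγ).sub (hJc.clm_apply continuousOn_const)) ?_ ?_ (lt_add_one _)
    t ht
  · refine key.trans ?_
    calc _ = (ε * R) * ‖h‖ := by rw [hR]; ring
      _ ≤ c * ‖h‖ := by gcongr
  · intro t ht
    have hst : Icc s t ⊆ Icc s T := Icc_subset_Icc_right ht.2
    have i1 := ((hX.continuousOn_comp (hX.flow_cont (x + h) s hs)).mono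
      hst).intervalIntegrable_of_Icc (μ := volume) ht.1
    have i2 := ((hX.continuousOn_comp hγ).mono hst).intervalIntegrable_of_Icc (μ := volume) ht.1
    have i3 := ((hA.clm_comp hJc).mono hst).intervalIntegrable_of_Icc (μ := volume) ht.1
    have i4 := ((hA.clm_apply (hJc.clm_apply continuousOn_const (g := fun _ => h))).mono
      hst).intervalIntegrable_of_Icc (μ := volume) ht.1
    have e : J t h = h + ∫ τ in s..t, fderiv ℝ (F τ) (X s τ x) (J τ h) := by
      conv_lhs => rw [hJ' t ht]
      rw [add_apply, ContinuousLinearMap.intervalIntegral_apply i3]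
      simp
    rw [intervalIntegral.integral_sub (i1.sub i2) i4, intervalIntegral.integral_sub i1 i2, e,
      hX.flow_eq (x + h) s hs t ht, hX.flow_eq x s hs t ht]
    refine (norm_eq_zero.2 ?_).le
    abel
  · intro τ hτ _
    have h1 := hlin τ hτ _ ((hh τ hτ).trans_lt hhδ)
    have h2 : F τ (X s τ (x + h)) - F τ (X s τ x) - fderiv ℝ (F τ) (X s τ x) (J τ h) =
      fderiv ℝ (F τ) (X s τ x) (X s τ (x + h) - X s τ x - J τ h) +
      (F τ (X s τ (x + h)) - F τ (X s τ x) -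
        fderiv ℝ (F τ) (X s τ x) (X s τ (x + h) - X s τ x)) := by
      rw [map_sub (fderiv ℝ (F τ) (X s τ x)) (X s τ (x + h) - X s τ x)]
      abel
    rw [h2]
    refine (norm_add_le _ _).trans (add_le_add ?_ (h1.trans ?_))
    · exact (ContinuousLinearMap.le_opNorm _ _).trans (by gcongr; exact hM τ hτ)
    · gcongr
      exact hh τ hτ

theorem hasFDerivAt_flow (hX : IsC1Flow T F X) {s t : ℝ} (hs : s ∈ Icc 0 T) (ht : t ∈ Icc s T)
    (x : V) : HasFDerivAt (X s t) (fderiv ℝ (X s t) x) x := by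
  obtain ⟨J, -, -, h⟩ := hX.exists_hasFDerivAt hs x
  exact (h t ht).differentiableAt.hasFDerivAt

theorem continuousOn_fderiv_time (hX : IsC1Flow T F X) {s : ℝ} (hs : s ∈ Icc 0 T) (x : V) :
    ContinuousOn (fun t => fderiv ℝ (X s t) x) (Icc s T) := by
  obtain ⟨J, hJ, -, h⟩ := hX.exists_hasFDerivAt hs x
  exact hJ.congr fun t ht => (h t ht).fderiv

theorem fderiv_flow_eq (hX : IsC1Flow T F X) {s t : ℝ} (hs : s ∈ Icc 0 T) (ht : t ∈ Icc s T)
    (x : V) : fderiv ℝ (X s t) x = ContinuousLinearMap.id ℝ V +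
      ∫ τ in s..t, (fderiv ℝ (F τ) (X s τ x)).comp (fderiv ℝ (X s τ) x) := by
  obtain ⟨J, -, hJ, h⟩ := hX.exists_hasFDerivAt hs x
  rw [(h t ht).fderiv, hJ t ht]
  congr 1
  refine intervalIntegral.integral_congr fun τ hτ => ?_
  rw [uIcc_of_le ht.1] at hτ
  simp [(h τ ⟨hτ.1, hτ.2.trans ht.2⟩).fderiv]

/-- Both derivatives solve variational equations whose coefficients are uniformly close, since the
trajectories are. As `fderiv ℝ (F τ)` is merely continuous, this yields closeness without a rate. -/
theorem eventually_norm_fderiv_flow_sub_lt (hX : IsC1Flow T F X) {s₀ : ℝ} (hs₀ : s₀ ∈ Icc 0 T)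
    (x₀ : V) {ε : ℝ} (hε : 0 < ε) : ∀ᶠ p in 𝓝 (s₀, x₀), p.1 ∈ Icc 0 T → ∀ t ∈ Icc p.1 T,
      ‖fderiv ℝ (X p.1 t) p.2 - fderiv ℝ (X s₀ (max s₀ t)) x₀‖ < ε := by
  set γ : ℝ → V := fun t => X s₀ (max s₀ t) x₀ with hγ
  set J₀ : ℝ → V →L[ℝ] V := fun t => fderiv ℝ (X s₀ (max s₀ t)) x₀ with hJ₀
  have hγc : ContinuousOn γ (Icc 0 T) := continuousOn_comp_max hs₀ (hX.flow_cont x₀ s₀ hs₀)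
  have hJc : ContinuousOn J₀ (Icc 0 T) :=
    continuousOn_comp_max hs₀ (hX.continuousOn_fderiv_time hs₀ x₀)
  have hA := hX.continuousOn_fderiv_comp hγc
  have hpc := hA.clm_comp hJc
  obtain ⟨M, hM⟩ := isCompact_Icc.exists_bound_of_continuousOn hpc
  obtain ⟨L, hL⟩ := isCompact_Icc.exists_bound_of_continuousOn hA
  obtain ⟨B, hB⟩ := isCompact_Icc.exists_bound_of_continuousOn hJc
  have hM0 : 0 ≤ M := (norm_nonneg _).trans (hM s₀ hs₀)
  have hL0 : 0 ≤ L := (norm_nonneg _).trans (hL s₀ hs₀)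
  have hB0 : 0 ≤ B := (norm_nonneg _).trans (hB s₀ hs₀)
  have hT : 0 ≤ T := hs₀.1.trans hs₀.2
  set R := Real.exp ((L + 1) * T) with hR
  -- The cap `1` bounds the perturbed coefficient by `L + 1`; the other entry makes the source
  -- contribute at most `ε / 2`.
  set ε' := min 1 (ε / 2 / (B * T * R + 1)) with hε'
  have hε'0 : 0 < ε' := by positivity
  have hε'R : ε' * (B * T * R) ≤ ε / 2 := by
    have h1 : ε' ≤ ε / 2 / (B * T * R + 1) := min_le_right _ _
    rw [le_div_iff₀ (by positivity)] at h1
    nlinarith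
  obtain ⟨δ, hδ, htube⟩ := hX.cont_fderiv.exists_uniform_tube isCompact_Icc hγc hε'0
  have hev : ∀ᶠ p : ℝ × V in 𝓝 (s₀, x₀), M * |p.1 - s₀| * R < ε / 2 := by
    have : Continuous fun p : ℝ × V => M * |p.1 - s₀| * R := by fun_prop
    exact this.continuousAt.eventually_lt continuousAt_const (by simpa using hε)
  filter_upwards [hev, hX.eventually_norm_flow_sub_lt hs₀ x₀ hδ] with p hp hpδ hs t ht
  obtain ⟨s, x⟩ := p
  simp only at hp hpδ hs ht ⊢
  have hsub : Icc s T ⊆ Icc 0 T := Icc_subset_Icc_left hs.1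
  have hγs := hX.flow_cont x s hs
  have hJs := hX.continuousOn_fderiv_time hs x
  have hbound : (M * |s - s₀| + ε' * B * (T - s)) * Real.exp ((L + 1) * (T - s)) < ε := by
    have h1 : Real.exp ((L + 1) * (T - s)) ≤ R := by
      rw [hR]; gcongr; linarith [hs.1]
    calc _ ≤ (M * |s - s₀| + ε' * B * T) * R := by
          have := sub_nonneg.2 hs.2
          gcongr
          linarith [hs.1]
      _ = M * |s - s₀| * R + ε' * (B * T * R) := by ring
      _ < ε := by linarith
  refine (norm_le_mul_exp_of_integral_approx (D := M * |s - s₀|) (η := ε' * B) (r := ε)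
    (w := fun t => fderiv ℝ (X s t) x - J₀ t)
    (q := fun τ => (fderiv ℝ (F τ) (X s τ x)).comp (fderiv ℝ (X s τ) x) -
      (fderiv ℝ (F τ) (γ τ)).comp (J₀ τ)) hs.2 (add_nonneg hL0 zero_le_one) (by positivity)
    (hJs.sub (hJc.mono hsub)) (fun t ht => ?_) (fun τ hτ _ => ?_) hbound t ht).trans_lt hbound
  · have h1 := norm_comp_max_sub_integral_le hs₀ hs ht hpc hM
      (u := fun t => fderiv ℝ (X s₀ t) x₀) (x := ContinuousLinearMap.id ℝ V) (fun t ht => by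
        rw [hX.fderiv_flow_eq hs₀ ht x₀]
        congr 1
        refine intervalIntegral.integral_congr fun τ hτ => ?_
        rw [uIcc_of_le ht.1] at hτ
        simp [hγ, hJ₀, max_eq_right hτ.1])
    have hst : Icc s t ⊆ Icc s T := Icc_subset_Icc_right ht.2
    rw [intervalIntegral.integral_sub
      ((((hX.continuousOn_fderiv_comp hγs).clm_comp hJs).mono hst).intervalIntegrable_of_Icc ht.1)
      ((hpc.mono (hst.trans hsub)).intervalIntegrable_of_Icc ht.1), hX.fderiv_flow_eq hs ht x,
      ← norm_neg]
    refine (le_of_eq ?_).trans h1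
    congr 1
    abel
  · have h1 : (fderiv ℝ (F τ) (X s τ x)).comp (fderiv ℝ (X s τ) x) -
        (fderiv ℝ (F τ) (γ τ)).comp (J₀ τ) =
        (fderiv ℝ (F τ) (X s τ x)).comp (fderiv ℝ (X s τ) x - J₀ τ) +
        (fderiv ℝ (F τ) (X s τ x) - fderiv ℝ (F τ) (γ τ)).comp (J₀ τ) := by
      rw [ContinuousLinearMap.comp_sub, ContinuousLinearMap.sub_comp]
      abel
    have h2 : ‖fderiv ℝ (F τ) (X s τ x) - fderiv ℝ (F τ) (γ τ)‖ < ε' :=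
      htube τ (hsub hτ) _ (hpδ hs τ hτ)
    have h3 : ‖fderiv ℝ (F τ) (X s τ x)‖ ≤ L + 1 := by
      have := norm_add_le (fderiv ℝ (F τ) (X s τ x) - fderiv ℝ (F τ) (γ τ)) (fderiv ℝ (F τ) (γ τ))
      rw [sub_add_cancel] at this
      linarith [hL τ (hsub hτ), min_le_left 1 (ε / 2 / (B * T * R + 1))]
    rw [h1]
    refine (norm_add_le _ _).trans (add_le_add ?_ ?_)
    · exact (ContinuousLinearMap.opNorm_comp_le _ _).trans (by gcongr)
    · exact (ContinuousLinearMap.opNorm_comp_le _ _).trans (by gcongr; exact hB τ (hsub hτ))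

theorem continuousOn_fderiv_flow (hX : IsC1Flow T F X) :
    ContinuousOn (fun p : ℝ × ℝ × V => fderiv ℝ (X p.1 p.2.1) p.2.2)
      {p | 0 ≤ p.1 ∧ p.1 ≤ p.2.1 ∧ p.2.1 ≤ T} := by
  rintro ⟨s₀, t₀, x₀⟩ ⟨h0, h1, h2⟩
  simp only at h0 h1 h2
  have hs₀ : s₀ ∈ Icc 0 T := ⟨h0, h1.trans h2⟩
  exact continuousWithinAt_of_eventually_norm_sub_lt (G := fun s t x => fderiv ℝ (X s t) x)
    (γ := fun t => fderiv ℝ (X s₀ (max s₀ t)) x₀)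
    (continuousOn_comp_max hs₀ (hX.continuousOn_fderiv_time hs₀ x₀)) ⟨h0.trans h1, h2⟩
    (by simp only [max_eq_right h1]) fun ε hε => hX.eventually_norm_fderiv_flow_sub_lt hs₀ x₀ hε

end IsC1Flow

/-! ### Calculus tools: integrability, mean value estimate, partial derivatives -/

theorem ContinuousOn.integrableOn_clm_apply {V W : Type*} [NormedAddCommGroup V] [NormedSpace ℝ V]
    [NormedAddCommGroup W] [NormedSpace ℝ W] {a b : ℝ} {L : ℝ → V →L[ℝ] W} {E : ℝ → V}
    (hL : ContinuousOn L (Icc a b)) (hE : IntegrableOn E (Icc a b)) :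
    IntegrableOn (fun τ => L τ (E τ)) (Icc a b) := by
  obtain ⟨M, hM⟩ := isCompact_Icc.exists_bound_of_continuousOn hL
  refine (hE.norm.const_mul M).mono' ?_ ?_
  · exact (isBoundedBilinearMap_apply.continuous : Continuous fun p : (V →L[ℝ] W) × V =>
      p.1 p.2).comp_aestronglyMeasurable
        ((hL.aestronglyMeasurable measurableSet_Icc).prodMk hE.aestronglyMeasurable)
  · filter_upwards [ae_restrict_mem measurableSet_Icc] with τ hτ
    exact (ContinuousLinearMap.le_opNorm _ _).trans (by gcongr; exact hM τ hτ)

/-- Strict differentiability for a varying map, from the mean value inequality on a small ball. It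
serves for `X r' t` as `r' ↓ r`, where map and points move together. -/
theorem eventually_norm_sub_sub_fderiv_le {ι V W : Type*} [NormedAddCommGroup V] [NormedSpace ℝ V]
    [NormedAddCommGroup W] [NormedSpace ℝ W] {l : Filter ι} {u : V} {v w : ι → V}
    (hv : Tendsto v l (𝓝 u)) (hw : Tendsto w l (𝓝 u)) {f : ι → V → W} {φ : V →L[ℝ] W}
    (df : ∀ᶠ i in l, Differentiable ℝ (f i))
    (cf : Tendsto (fun p : ι × V => fderiv ℝ (f p.1) p.2) (l ×ˢ 𝓝 u) (𝓝 φ)) {ε : ℝ} (hε : 0 < ε) :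
    ∀ᶠ i in l, ‖f i (v i) - f i (w i) - φ (v i - w i)‖ ≤ ε * ‖v i - w i‖ := by
  obtain ⟨p, hp, q, hq, hpq⟩ := eventually_prod_iff.1 (Metric.tendsto_nhds.1 cf ε hε)
  obtain ⟨δ, hδ, hball⟩ := Metric.eventually_nhds_iff_ball.1 hq
  filter_upwards [hp, df, hv (Metric.ball_mem_nhds u hδ), hw (Metric.ball_mem_nhds u hδ)]
    with i hpi hdi hvi hwi
  exact (convex_ball u δ).norm_image_sub_le_of_norm_fderiv_le' (𝕜 := ℝ) (fun z _ => hdi z)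
    (fun z hz => by simpa [dist_eq_norm] using (hpq hpi (hball z hz)).le) hwi hvi

theorem ContinuousOn.clm_coprod {Z E₁ E₂ G : Type*} [TopologicalSpace Z] [NormedAddCommGroup E₁]
    [NormedSpace ℝ E₁] [NormedAddCommGroup E₂] [NormedSpace ℝ E₂] [NormedAddCommGroup G]
    [NormedSpace ℝ G] {U : Set Z} {f₁ : Z → E₁ →L[ℝ] G} {f₂ : Z → E₂ →L[ℝ] G}
    (c₁ : ContinuousOn f₁ U) (c₂ : ContinuousOn f₂ U) :
    ContinuousOn (fun z => (f₁ z).coprod (f₂ z)) U := by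
  have h : (fun z => (f₁ z).coprod (f₂ z)) = fun z =>
      (f₁ z).comp (ContinuousLinearMap.fst ℝ E₁ E₂) +
        (f₂ z).comp (ContinuousLinearMap.snd ℝ E₁ E₂) := by
    ext z x <;> simp
  rw [h]
  exact (c₁.clm_comp continuousOn_const).add (c₂.clm_comp continuousOn_const)

theorem hasFDerivAt_of_continuousOn_partial {E₁ E₂ G : Type*} [NormedAddCommGroup E₁]
    [NormedSpace ℝ E₁] [NormedAddCommGroup E₂] [NormedSpace ℝ E₂] [NormedAddCommGroup G]
    [NormedSpace ℝ G] {U : Set (E₁ × E₂)} (hU : IsOpen U) {f : E₁ → E₂ → G}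
    {f₁ : E₁ × E₂ → E₁ →L[ℝ] G} {f₂ : E₁ × E₂ → E₂ →L[ℝ] G}
    (h₁ : ∀ u ∈ U, HasFDerivAt (fun x => f x u.2) (f₁ u) u.1)
    (h₂ : ∀ u ∈ U, HasFDerivAt (f u.1) (f₂ u) u.2)
    (c₁ : ContinuousOn f₁ U) (c₂ : ContinuousOn f₂ U) {u : E₁ × E₂} (hu : u ∈ U) :
    HasFDerivAt (fun p : E₁ × E₂ => f p.1 p.2) ((f₁ u).coprod (f₂ u)) u := by
  have hUu := hU.mem_nhds hu
  exact (hasStrictFDerivAt_uncurry_coprod (f := f) (f₁ := fun x y => f₁ (x, y))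
    (f₂ := fun x y => f₂ (x, y)) (mem_of_superset hUu h₁) (mem_of_superset hUu h₂)
    (c₁.continuousAt hUu) (c₂.continuousAt hUu)).hasFDerivAt

/-! ### The Alekseev–Gröbner formula -/

namespace IsC1Flow

variable {V : Type*} [NormedAddCommGroup V] [NormedSpace ℝ V] {T : ℝ} {F : ℝ → V → V}
  {X : ℝ → ℝ → V → V}

theorem continuousOn_flow_left (hX : IsC1Flow T F X) {t : ℝ} (ht : t ≤ T) {Y : ℝ → V}
    (hY : ContinuousOn Y (Icc 0 T)) : ContinuousOn (fun τ => X τ t (Y τ)) (Icc 0 t) :=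
  hX.continuousOn_flow.comp (f := fun τ => (τ, t, Y τ))
    (continuousOn_id.prodMk (continuousOn_const.prodMk (hY.mono (Icc_subset_Icc_right ht))))
    fun _ hτ => ⟨hτ.1, hτ.2, ht⟩

/-- The defect `Y s' - X s s' (Y s)` of a perturbed solution is the integral of the perturbation up
to an error of smaller order than `s' - s`. -/
theorem eventually_norm_defect_sub_le (hX : IsC1Flow T F X) {Y E : ℝ → V}
    (hYc : ContinuousOn Y (Icc 0 T)) (hE : IntegrableOn E (Icc 0 T))
    (hY : ∀ t ∈ Icc 0 T, Y t = Y 0 + ∫ τ in (0 : ℝ)..t, (F τ (Y τ) + E τ))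
    {s : ℝ} (hs : s ∈ Ico 0 T) {ε : ℝ} (hε : 0 < ε) :
    ∀ᶠ s' in 𝓝[>] s, ‖Y s' - X s s' (Y s) - ∫ τ in s..s', E τ‖ ≤ ε * (s' - s) := by
  have hs0 : s ∈ Icc 0 T := ⟨hs.1, hs.2.le⟩
  have hsub : Icc s T ⊆ Icc 0 T := Icc_subset_Icc_left hs.1
  have hc := hX.flow_cont (Y s) s hs0
  have hFY := hX.continuousOn_comp hYc
  have hFX := hX.continuousOn_comp hc
  -- The error is the integral of this function, which is continuous and vanishes at `s` because
  -- both paths are at `Y s` there.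
  have hd : ContinuousWithinAt (fun τ => F τ (Y τ) - F τ (X s τ (Y s))) (Icc s T) s :=
    ((hFY.mono hsub).sub hFX) s ⟨le_rfl, hs.2.le⟩
  have hnhds : Icc s T ∈ 𝓝[≥] s := Icc_mem_nhdsGE hs.2
  have hd' : ∀ᶠ τ in 𝓝[≥] s, ‖F τ (Y τ) - F τ (X s τ (Y s))‖ < ε := by
    have := (hd.mono_of_mem_nhdsWithin hnhds).norm.eventually_lt (continuousWithinAt_const (b := ε))
      (by simpa [hX.flow_self hs0] using hε)
    exact this
  obtain ⟨u, hu, hu'⟩ := mem_nhdsGE_iff_exists_Ico_subset.1 hd'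
  filter_upwards [Ioo_mem_nhdsGT (lt_min hu hs.2)] with s' hs'
  have hs'u : s' < u := hs'.2.trans_le (min_le_left _ _)
  have hs'T : s' ≤ T := hs'.2.le.trans (min_le_right _ _)
  have hss' : s ≤ s' := hs'.1.le
  have hs'0 : s' ∈ Icc 0 T := ⟨hs.1.trans hss', hs'T⟩
  have i1 : ∀ c ∈ Icc 0 T, ∀ d ∈ Icc 0 T, IntervalIntegrable E volume c d := fun c hc d hd =>
    (hE.mono_set (uIcc_subset_Icc hc hd)).intervalIntegrable
  have i2 : ∀ c ∈ Icc 0 T, ∀ d ∈ Icc 0 T, IntervalIntegrable (fun τ => F τ (Y τ)) volume c d :=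
    fun c hc d hd => (hFY.mono (uIcc_subset_Icc hc hd)).intervalIntegrable
  have i3 := (hFX.mono (Icc_subset_Icc_right hs'T)).intervalIntegrable_of_Icc (μ := volume) hss'
  have h0 : (0 : ℝ) ∈ Icc 0 T := ⟨le_rfl, hs.1.trans hs.2.le⟩
  have hYY : Y s' = Y s + ∫ τ in s..s', (F τ (Y τ) + E τ) := by
    rw [hY s' hs'0, hY s hs0, add_assoc, intervalIntegral.integral_add_adjacent_intervals]
    · exact (i2 0 h0 s hs0).add (i1 0 h0 s hs0)
    · exact (i2 s hs0 s' hs'0).add (i1 s hs0 s' hs'0)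
  have e : Y s' - X s s' (Y s) - ∫ τ in s..s', E τ =
      ∫ τ in s..s', (F τ (Y τ) - F τ (X s τ (Y s))) := by
    rw [hX.flow_eq (Y s) s hs0 s' ⟨hss', hs'T⟩, hYY,
      intervalIntegral.integral_add (i2 s hs0 s' hs'0) (i1 s hs0 s' hs'0),
      intervalIntegral.integral_sub (i2 s hs0 s' hs'0) i3]
    abel
  rw [e, ← abs_of_nonneg (sub_nonneg.2 hss')]
  refine intervalIntegral.norm_integral_le_of_norm_le_const fun τ hτ => ?_
  rw [uIoc_of_le hss'] at hτ
  exact (hu' ⟨hτ.1.le, hτ.2.trans_lt hs'u⟩ : _ < ε).le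

variable [CompleteSpace V]

theorem continuousOn_fderiv_left (hX : IsC1Flow T F X) {t : ℝ} (ht : t ≤ T) {Y : ℝ → V}
    (hY : ContinuousOn Y (Icc 0 T)) :
    ContinuousOn (fun τ => fderiv ℝ (X τ t) (Y τ)) (Icc 0 t) :=
  hX.continuousOn_fderiv_flow.comp (f := fun τ => (τ, t, Y τ))
    (continuousOn_id.prodMk (continuousOn_const.prodMk (hY.mono (Icc_subset_Icc_right ht))))
    fun _ hτ => ⟨hτ.1, hτ.2, ht⟩

theorem alekseev_groebner (hX : IsC1Flow T F X) {Y E : ℝ → V}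
    (hYc : ContinuousOn Y (Icc 0 T)) (hE : IntegrableOn E (Icc 0 T))
    (hY : ∀ t ∈ Icc 0 T, Y t = Y 0 + ∫ τ in (0 : ℝ)..t, (F τ (Y τ) + E τ))
    {s t : ℝ} (hs : 0 ≤ s) (hst : s ≤ t) (ht : t ≤ T) :
    Y t = X s t (Y s) + ∫ τ in s..t, fderiv ℝ (X τ t) (Y τ) (E τ) := by
  have hDc := hX.continuousOn_fderiv_left ht hYc
  have hDE := hDc.integrableOn_clm_apply (hE.mono_set (Icc_subset_Icc_right ht))
  have hsub : Icc s t ⊆ Icc 0 t := Icc_subset_Icc_left hs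
  have hsubT : Icc 0 t ⊆ Icc 0 T := Icc_subset_Icc_right ht
  set H : ℝ → V := fun r => X r t (Y r) - ∫ τ in s..r, fderiv ℝ (X τ t) (Y τ) (E τ) with hH
  -- The term `r` pays for the drift error, the integral for the perturbation, which need not be
  -- bounded.
  set m : ℝ → ℝ := fun r => r + ∫ τ in s..r, ‖E τ‖ with hm
  have hu : uIcc s t = Icc s t := uIcc_of_le hst
  have hHc : ContinuousOn H (Icc s t) := by
    refine ((hX.continuousOn_flow_left ht hYc).mono hsub).sub ?_
    rw [← hu]
    exact intervalIntegral.continuousOn_primitive_interval (by rw [hu]; exact hDE.mono_set hsub)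
  have hmc : ContinuousOn m (Icc s t) := by
    refine continuousOn_id.add ?_
    rw [← hu]
    exact intervalIntegral.continuousOn_primitive_interval
      (by rw [hu]; exact IntegrableOn.mono_set hE.norm (hsub.trans hsubT))
  have key := eq_of_forall_eventually_norm_sub_le hst hHc hmc fun r hr ε hε => by
    have hr0 : r ∈ Icc 0 t := ⟨hs.trans hr.1, hr.2.le⟩
    have hrT : r ∈ Ico 0 T := ⟨hr0.1, hr.2.trans_le ht⟩
    have hrT' : r ∈ Icc 0 T := ⟨hr0.1, hrT.2.le⟩
    set D₀ := fderiv ℝ (X r t) (Y r) with hD₀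
    -- Three errors add up to `2 + ‖D₀‖` multiples of `ε₁`: linearizing `X r' t`, the defect seen
    -- through `D₀`, and replacing the derivative by `D₀` under the integral.
    set ε₁ := min 1 (ε / (2 + ‖D₀‖)) with hε₁
    have hε₁0 : 0 < ε₁ := by positivity
    have hε₁1 : ε₁ ≤ 1 := min_le_left _ _
    have hε₁ε : ε₁ * (2 + ‖D₀‖) ≤ ε := by
      have h : ε₁ ≤ ε / (2 + ‖D₀‖) := min_le_right _ _
      rwa [le_div_iff₀ (by positivity)] at h
    have hle : 𝓝[>] r ≤ 𝓝[Icc 0 T] r := by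
      rw [nhdsWithin, nhdsWithin]
      refine le_inf inf_le_left ?_
      rw [← nhdsWithin, le_principal_iff]
      filter_upwards [Ioo_mem_nhdsGT hrT.2] with z hz using ⟨hr0.1.trans hz.1.le, hz.2.le⟩
    have hv : Tendsto Y (𝓝[>] r) (𝓝 (Y r)) := (hYc r hrT').mono_left hle
    have hw : Tendsto (fun r' => X r r' (Y r)) (𝓝[>] r) (𝓝 (Y r)) := by
      have h : Tendsto (fun r' => X r r' (Y r)) (𝓝[Icc r T] r) (𝓝 (X r r (Y r))) :=
        hX.flow_cont (Y r) r hrT' r ⟨le_rfl, hrT.2.le⟩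
      rw [hX.flow_self hrT'] at h
      refine h.mono_left ?_
      rw [nhdsWithin, nhdsWithin]
      refine le_inf inf_le_left ?_
      rw [← nhdsWithin, le_principal_iff]
      filter_upwards [Ioo_mem_nhdsGT hrT.2] with z hz using ⟨hz.1.le, hz.2.le⟩
    have hIoo : ∀ᶠ r' in 𝓝[>] r, r' ∈ Ioo r t := Ioo_mem_nhdsGT hr.2
    have ho := eventually_norm_sub_sub_fderiv_le hv hw (f := fun r' => X r' t) (φ := D₀)
      (hIoo.mono fun r' hr' x => (hX.hasFDerivAt_flow ⟨hr0.1.trans hr'.1.le, hr'.2.le.trans ht⟩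
        ⟨hr'.2.le, ht⟩ x).differentiableAt)
      (by
        have h := hX.continuousOn_fderiv_flow (r, t, Y r) ⟨hr0.1, hr0.2, ht⟩
        have h' : Tendsto (fun p : ℝ × V => (p.1, t, p.2)) (𝓝[>] r ×ˢ 𝓝 (Y r))
            (𝓝[{p : ℝ × ℝ × V | 0 ≤ p.1 ∧ p.1 ≤ p.2.1 ∧ p.2.1 ≤ T}] (r, t, Y r)) := by
          refine tendsto_nhdsWithin_iff.2 ⟨?_, ?_⟩
          · have hc : Continuous fun p : ℝ × V => (p.1, t, p.2) := by fun_prop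
            refine (hc.tendsto (r, Y r)).mono_left ?_
            rw [nhds_prod_eq]
            exact Filter.prod_mono_left _ nhdsWithin_le_nhds
          · filter_upwards [hIoo.prod_inl (𝓝 (Y r))] with p hp
            exact ⟨hr0.1.trans hp.1.le, hp.2.le, ht⟩
        exact h.tendsto.comp h') hε₁0
    have hDnear : ∀ᶠ r' in 𝓝[≥] r, ‖fderiv ℝ (X r' t) (Y r') - D₀‖ < ε₁ := by
      have h := (((hDc r hr0).mono_of_mem_nhdsWithin (s := Ici r) (by
        filter_upwards [Icc_mem_nhdsGE hr.2] with z hz using mem_Icc.2 ⟨hr0.1.trans hz.1, hz.2⟩)).sub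
        (continuousWithinAt_const (b := D₀))).norm
      exact h.eventually_lt (continuousWithinAt_const (b := ε₁)) (by simpa [hD₀] using hε₁0)
    obtain ⟨u, hur, huD⟩ := mem_nhdsGE_iff_exists_Ico_subset.1 hDnear
    filter_upwards [hIoo, Ioo_mem_nhdsGT hur, ho,
      hX.eventually_norm_defect_sub_le hYc hE hY hrT hε₁0] with r' hr' hr'u ho' hdef
    have hrr' : r ≤ r' := hr'.1.le
    have hr'0 : r' ∈ Icc 0 t := ⟨hr0.1.trans hrr', hr'.2.le⟩
    have iE : IntervalIntegrable E volume r r' :=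
      (hE.mono_set (uIcc_subset_Icc hrT' (hsubT hr'0))).intervalIntegrable
    have iN : ∀ c ∈ Icc 0 t, ∀ d ∈ Icc 0 t, IntervalIntegrable (fun τ => ‖E τ‖) volume c d :=
      fun c hc d hd => (IntegrableOn.mono_set hE.norm
        (uIcc_subset_Icc (hsubT hc) (hsubT hd))).intervalIntegrable
    have iD : ∀ c ∈ Icc 0 t, ∀ d ∈ Icc 0 t,
        IntervalIntegrable (fun τ => fderiv ℝ (X τ t) (Y τ) (E τ)) volume c d :=
      fun c hc d hd => (hDE.mono_set (uIcc_subset_Icc hc hd)).intervalIntegrable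
    have hs0 : s ∈ Icc 0 t := ⟨hs, hst⟩
    have hΔm : m r' - m r = (r' - r) + ∫ τ in r..r', ‖E τ‖ := by
      simp only [hm]
      rw [← intervalIntegral.integral_interval_sub_left (iN s hs0 r' hr'0) (iN s hs0 r hr0)]
      ring
    set I := ∫ τ in r..r', ‖E τ‖ with hI
    have hI0 : 0 ≤ I := intervalIntegral.integral_nonneg hrr' fun _ _ => norm_nonneg _
    set e := Y r' - X r r' (Y r) with he
    have hEI : ‖∫ τ in r..r', E τ‖ ≤ I := intervalIntegral.norm_integral_le_integral_norm hrr'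
    have hd0 : 0 ≤ r' - r := sub_nonneg.2 hrr'
    have heΔ : ‖e‖ ≤ m r' - m r := by
      have h1 := norm_add_le (e - ∫ τ in r..r', E τ) (∫ τ in r..r', E τ)
      rw [sub_add_cancel] at h1
      rw [hΔm]
      nlinarith
    have hDD : ‖∫ τ in r..r', (fderiv ℝ (X τ t) (Y τ) - D₀) (E τ)‖ ≤ ε₁ * I := by
      rw [hI, ← intervalIntegral.integral_const_mul]
      refine intervalIntegral.norm_integral_le_of_norm_le hrr' (ae_of_all _ fun τ hτ => ?_)
        ((iN r hr0 r' hr'0).const_mul ε₁)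
      have h1 : ‖fderiv ℝ (X τ t) (Y τ) - D₀‖ < ε₁ := huD ⟨hτ.1.le, hτ.2.trans_lt hr'u.2⟩
      exact (ContinuousLinearMap.le_opNorm _ _).trans (by gcongr)
    -- The flow property lets both points be fed to the same map `X r' t`.
    have hsplit : H r' - H r = (X r' t (Y r') - X r' t (X r r' (Y r)) - D₀ e) +
        D₀ (e - ∫ τ in r..r', E τ) - ∫ τ in r..r', (fderiv ℝ (X τ t) (Y τ) - D₀) (E τ) := by
      simp only [hH, sub_apply]
      rw [hX.flow_comp hr0.1 hrr' hr'.2.le ht, map_sub D₀ e,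
        intervalIntegral.integral_sub (iD r hr0 r' hr'0) 
          ⟨D₀.integrable_comp iE.1, D₀.integrable_comp iE.2⟩,
        ContinuousLinearMap.intervalIntegral_comp_comm _ iE,
        ← intervalIntegral.integral_interval_sub_left (iD s hs0 r' hr'0) (iD s hs0 r hr0)]
      abel
    rw [hsplit]
    have h1 : ‖D₀ (e - ∫ τ in r..r', E τ)‖ ≤ ‖D₀‖ * (ε₁ * (r' - r)) :=
      (ContinuousLinearMap.le_opNorm _ _).trans (by gcongr)
    have h2 : ‖X r' t (Y r') - X r' t (X r r' (Y r)) - D₀ e‖ ≤ ε₁ * (m r' - m r) :=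
      ho'.trans (by gcongr)
    have hΔ0 : 0 ≤ m r' - m r := (norm_nonneg _).trans heΔ
    calc _ ≤ ε₁ * (m r' - m r) + ‖D₀‖ * (ε₁ * (r' - r)) + ε₁ * I :=
          (norm_sub_le _ _).trans (add_le_add ((norm_add_le _ _).trans (add_le_add h2 h1)) hDD)
      _ ≤ ε₁ * (m r' - m r) + ‖D₀‖ * (ε₁ * (m r' - m r)) + ε₁ * (m r' - m r) := by
          have h3 : r' - r ≤ m r' - m r := by linarith
          have h4 : I ≤ m r' - m r := by linarith
          exact add_le_add (add_le_add le_rfl (by gcongr)) (by gcongr)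
      _ = ε₁ * (2 + ‖D₀‖) * (m r' - m r) := by ring
      _ ≤ ε * (m r' - m r) := by gcongr
  simp only [hH, intervalIntegral.integral_same, sub_zero] at key
  rw [hX.flow_self ⟨hs.trans hst, ht⟩] at key
  exact sub_eq_iff_eq_add.1 key

/-! ### Joint continuous differentiability -/

/-- A constant path is a perturbed solution whose perturbation cancels the drift. The starting time
now appears only as an integration limit and can be differentiated. -/
theorem flow_eq_add_integral_fderiv (hX : IsC1Flow T F X) {s t : ℝ} (hs : 0 ≤ s) (hst : s ≤ t)
    (ht : t ≤ T) (x : V) : X s t x = x + ∫ τ in s..t, fderiv ℝ (X τ t) x (F τ x) := by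
  have hF : Continuous fun τ => F τ x := hX.cont.comp (f := fun τ => (τ, x)) (by fun_prop)
  have h := hX.alekseev_groebner (Y := fun _ => x) (E := fun τ => -F τ x) continuousOn_const
    (hF.neg.continuousOn.integrableOn_compact isCompact_Icc) (by simp) hs hst ht
  simp only [map_neg, intervalIntegral.integral_neg] at h
  rw [← sub_eq_add_neg, eq_sub_iff_add_eq] at h
  exact h.symm

theorem hasDerivAt_right (hX : IsC1Flow T F X) {s t : ℝ} (hs : 0 ≤ s) (hst : s < t) (ht : t < T)
    (x : V) : HasDerivAt (fun t => X s t x) (F t (X s t x)) t := by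
  have hs' : s ∈ Icc 0 T := ⟨hs, (hst.trans ht).le⟩
  have hc := hX.continuousOn_comp (hX.flow_cont x s hs')
  have h := (intervalIntegral.integral_hasDerivAt_right (a := s) (b := t)
    ((hc.mono (Icc_subset_Icc_right ht.le)).intervalIntegrable_of_Icc hst.le)
    ((hc.mono Ioo_subset_Icc_self).stronglyMeasurableAtFilter isOpen_Ioo t ⟨hst, ht⟩)
    (hc.continuousAt (Icc_mem_nhds hst ht))).const_add x
  refine h.congr_of_eventuallyEq ?_
  filter_upwards [Ioo_mem_nhds hst ht] with r hr
  exact hX.flow_eq x s hs' r ⟨hr.1.le, hr.2.le⟩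

theorem hasDerivAt_left (hX : IsC1Flow T F X) {s t : ℝ} (hs : 0 < s) (hst : s < t) (ht : t ≤ T)
    (x : V) : HasDerivAt (fun s => X s t x) (-fderiv ℝ (X s t) x (F s x)) s := by
  have hF : Continuous fun τ => F τ x := hX.cont.comp (f := fun τ => (τ, x)) (by fun_prop)
  have hc : ContinuousOn (fun τ => fderiv ℝ (X τ t) x (F τ x)) (Icc 0 t) :=
    (hX.continuousOn_fderiv_left ht continuousOn_const).clm_apply hF.continuousOn
  have h := (intervalIntegral.integral_hasDerivAt_left (a := s) (b := t)
    ((hc.mono (Icc_subset_Icc_left hs.le)).intervalIntegrable_of_Icc hst.le)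
    ((hc.mono Ioo_subset_Icc_self).stronglyMeasurableAtFilter isOpen_Ioo s ⟨hs, hst⟩)
    (hc.continuousAt (Icc_mem_nhds hs hst))).const_add x
  refine h.congr_of_eventuallyEq ?_
  filter_upwards [Ioo_mem_nhds hs hst] with r hr
  exact hX.flow_eq_add_integral_fderiv hr.1.le hr.2.le ht x

theorem contDiffOn_flow (hX : IsC1Flow T F X) :
    ContDiffOn ℝ 1 (fun p : ℝ × ℝ × V => X p.1 p.2.1 p.2.2)
      {p | 0 < p.1 ∧ p.1 < p.2.1 ∧ p.2.1 < T} := by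
  set U : Set (ℝ × ℝ × V) := {p | 0 < p.1 ∧ p.1 < p.2.1 ∧ p.2.1 < T} with hU
  have hUo : IsOpen U :=
    (isOpen_lt continuous_const continuous_fst).and
      ((isOpen_lt continuous_fst (continuous_fst.comp continuous_snd)).and
        (isOpen_lt (continuous_fst.comp continuous_snd) continuous_const))
  have hsub : U ⊆ {p | 0 ≤ p.1 ∧ p.1 ≤ p.2.1 ∧ p.2.1 ≤ T} := fun p hp =>
    ⟨hp.1.le, hp.2.1.le, hp.2.2.le⟩
  have hXc := hX.continuousOn_flow.mono hsub
  have hDc := hX.continuousOn_fderiv_flow.mono hsub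
  let dt : ℝ × ℝ × V → ℝ →L[ℝ] V := fun p =>
    ContinuousLinearMap.toSpanSingleton ℝ (F p.2.1 (X p.1 p.2.1 p.2.2))
  let dx : ℝ × ℝ × V → V →L[ℝ] V := fun p => fderiv ℝ (X p.1 p.2.1) p.2.2
  let ds : ℝ × ℝ × V → ℝ →L[ℝ] V := fun p =>
    ContinuousLinearMap.toSpanSingleton ℝ (-fderiv ℝ (X p.1 p.2.1) p.2.2 (F p.1 p.2.2))
  have hspan : Continuous fun v : V => ContinuousLinearMap.toSpanSingleton ℝ v :=
    (ContinuousLinearMap.toSpanSingletonCLE (𝕜 := ℝ) (E := V)).continuous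
  have hdt : ContinuousOn dt U := hspan.comp_continuousOn
    (hX.cont.comp_continuousOn (f := fun p : ℝ × ℝ × V => (p.2.1, X p.1 p.2.1 p.2.2))
      (ContinuousOn.prodMk (by fun_prop) hXc))
  have hds : ContinuousOn ds U := hspan.comp_continuousOn
    (hDc.clm_apply (hX.cont.comp_continuousOn (f := fun p : ℝ × ℝ × V => (p.1, p.2.2))
      (by fun_prop))).neg
  have hmk : ∀ s : ℝ, Continuous fun q : ℝ × V => (s, q) := fun s => by fun_prop
  have hdtx : ContinuousOn (fun p => (dt p).coprod (dx p)) U := hdt.clm_coprod hDc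
  -- The two-variable criterion is used twice: for `(t, x)` with `s` fixed, then for `s` against the
  -- pair `(t, x)`.
  have hstx : ∀ p ∈ U, HasFDerivAt (fun q : ℝ × V => X p.1 q.1 q.2) ((dt p).coprod (dx p)) p.2 :=
    fun p hp => hasFDerivAt_of_continuousOn_partial (f := X p.1) (f₁ := fun q => dt (p.1, q))
      (f₂ := fun q => dx (p.1, q)) (hUo.preimage (hmk p.1))
      (fun q hq => (hX.hasDerivAt_right hq.1.le hq.2.1 hq.2.2 q.2).hasFDerivAt)
      (fun q hq => hX.hasFDerivAt_flow ⟨hq.1.le, (hq.2.1.trans hq.2.2).le⟩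
        ⟨hq.2.1.le, hq.2.2.le⟩ q.2)
      (hdt.comp (hmk p.1).continuousOn fun _ hq => hq)
      (hDc.comp (hmk p.1).continuousOn fun _ hq => hq) hp
  have hfull : ∀ p ∈ U, HasFDerivAt (fun p : ℝ × ℝ × V => X p.1 p.2.1 p.2.2)
      ((ds p).coprod ((dt p).coprod (dx p))) p :=
    fun p hp => hasFDerivAt_of_continuousOn_partial (f := fun s (q : ℝ × V) => X s q.1 q.2) hUo
      (fun q hq => (hX.hasDerivAt_left hq.1 hq.2.1 hq.2.2.le q.2.2).hasFDerivAt) hstx hds hdtx hp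
  have hcont : ContinuousOn (fun p => (ds p).coprod ((dt p).coprod (dx p))) U := hds.clm_coprod hdtx
  rw [← zero_add (1 : WithTop ℕ∞), contDiffOn_succ_iff_fderiv_of_isOpen hUo]
  exact ⟨fun p hp => (hfull p hp).differentiableAt.differentiableWithinAt, by simp,
    contDiffOn_zero.2 (hcont.congr fun p hp => (hfull p hp).fderiv)⟩

end IsC1Flow

/-! ### The theorem on `[0,T]` -/

theorem theorem1p1 {V : Type*} [NormedAddCommGroup V] [NormedSpace ℝ V] [CompleteSpace V]
    (T : ℝ) (hT : 0 < T)
    (f : ℝ → V → V)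
    -- `f` is continuous on `[0,T] × V`, with a continuous Fréchet derivative in the second variable
    (hf : ContinuousOn (fun p : ℝ × V => f p.1 p.2) (Icc 0 T ×ˢ univ))
    (hf_diff : ∀ t ∈ Icc 0 T, Differentiable ℝ (fun x => f t x))
    (hf_deriv : ContinuousOn (fun p : ℝ × V => fderiv ℝ (fun x => f p.1 x) p.2) (Icc 0 T ×ˢ univ))
    -- `X s t x` is the value at time `t ∈ [s,T]` of the solution started from `x` at time `s`
    (X : ℝ → ℝ → V → V)
    (hX_cont : ∀ x : V, ∀ s ∈ Icc 0 T, ContinuousOn (fun t => X s t x) (Icc s T))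
    (hX : ∀ x : V, ∀ s ∈ Icc 0 T, ∀ t ∈ Icc s T,
      X s t x = x + ∫ τ in s..t, f τ (X s τ x))
    (Y E : ℝ → V)
    (hY_meas : StronglyMeasurable (fun τ : Icc (0 : ℝ) T => Y τ))
    (hE_meas : StronglyMeasurable (fun τ : Icc (0 : ℝ) T => E τ))
    (h_int : ∫⁻ τ in Icc 0 T, (‖f τ (Y τ)‖ₑ + ‖E τ‖ₑ) < ∞)
    (hY : ∀ t ∈ Icc 0 T, Y t = Y 0 + ∫ τ in (0 : ℝ)..t, (f τ (Y τ) + E τ)) :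
    -- `(s,t,x) ↦ X s t x` is of class `C^{0,0,1}` on `{0 ≤ s ≤ t ≤ T} × V`
    (ContinuousOn (fun p : ℝ × ℝ × V => X p.1 p.2.1 p.2.2)
        {p | 0 ≤ p.1 ∧ p.1 ≤ p.2.1 ∧ p.2.1 ≤ T} ∧
      (∀ s ∈ Icc 0 T, ∀ t ∈ Icc s T, Differentiable ℝ (fun x => X s t x)) ∧
      ContinuousOn (fun p : ℝ × ℝ × V => fderiv ℝ (fun x => X p.1 p.2.1 x) p.2.2)
        {p | 0 ≤ p.1 ∧ p.1 ≤ p.2.1 ∧ p.2.1 ≤ T}) ∧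
    -- it is jointly continuously differentiable on the open set `{0 < s < t < T} × V`
    ContDiffOn ℝ 1 (fun p : ℝ × ℝ × V => X p.1 p.2.1 p.2.2)
      {p | 0 < p.1 ∧ p.1 < p.2.1 ∧ p.2.1 < T} ∧
    (∀ t ∈ Icc 0 T, StronglyMeasurable
      (fun τ : Icc (0 : ℝ) t => fderiv ℝ (fun x => X τ t x) (Y τ) (E τ))) ∧
    (∀ t ∈ Icc 0 T, IntegrableOn
      (fun τ => fderiv ℝ (fun x => X τ t x) (Y τ) (E τ)) (Icc 0 t)) ∧
    (∀ s ∈ Icc 0 T, ∀ t ∈ Icc s T,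
      Y t = X s t (Y s) + ∫ τ in s..t, fderiv ℝ (fun x => X τ t x) (Y τ) (E τ)) := by
  -- Clamping time to `[0,T]` makes the field and its spatial derivative continuous on all of `ℝ ×
  -- V` without changing the integral equations.
  set F : ℝ → V → V := fun t => f (projIcc 0 T hT.le t) with hF
  have hproj : ∀ t ∈ Icc 0 T, F t = f t := fun t ht => by simp only [hF, projIcc_of_mem hT.le ht]
  have hpc : Continuous fun p : ℝ × V => ((projIcc 0 T hT.le p.1 : ℝ), p.2) :=
    (continuous_subtype_val.comp (continuous_projIcc.comp continuous_fst)).prodMk continuous_snd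
  have hpm : ∀ p : ℝ × V, ((projIcc 0 T hT.le p.1 : ℝ), p.2) ∈ Icc 0 T ×ˢ (univ : Set V) :=
    fun p => ⟨(projIcc 0 T hT.le p.1).2, mem_univ _⟩
  have hflow : IsC1Flow T F X :=
    { cont := hf.comp_continuous hpc hpm
      diff := fun t => hf_diff _ (projIcc 0 T hT.le t).2
      cont_fderiv := hf_deriv.comp_continuous hpc hpm
      flow_cont := hX_cont
      flow_eq := fun x s hs t ht => by
        rw [hX x s hs t ht]
        congr 1
        refine intervalIntegral.integral_congr fun τ hτ => ?_
        rw [uIcc_of_le ht.1] at hτ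
        rw [hproj τ ⟨hs.1.trans hτ.1, hτ.2.trans ht.2⟩] }
  have hEm : AEStronglyMeasurable E (volume.restrict (Icc 0 T)) := by
    rw [← map_comap_subtype_coe measurableSet_Icc,
      (MeasurableEmbedding.subtype_coe measurableSet_Icc).aestronglyMeasurable_map_iff]
    exact hE_meas.aestronglyMeasurable
  have hE : IntegrableOn E (Icc 0 T) :=
    ⟨hEm, (lintegral_mono fun τ => le_add_self).trans_lt h_int⟩
  have hFm : AEStronglyMeasurable (fun τ => f τ (Y τ)) (volume.restrict (Icc 0 T)) := by
    rw [← map_comap_subtype_coe measurableSet_Icc,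
      (MeasurableEmbedding.subtype_coe measurableSet_Icc).aestronglyMeasurable_map_iff]
    exact (hflow.cont.comp_stronglyMeasurable
      (measurable_subtype_coe.stronglyMeasurable.prodMk hY_meas)).aestronglyMeasurable.congr
        (ae_of_all _ fun τ => by simp [hproj τ τ.2])
  have hfY : IntegrableOn (fun τ => f τ (Y τ)) (Icc 0 T) :=
    ⟨hFm, (lintegral_mono fun τ => le_self_add).trans_lt h_int⟩
  -- `Y` is given as merely measurable, but its equation exhibits it as a primitive of an integrable
  -- function.
  have hYc : ContinuousOn Y (Icc 0 T) := by
    have h := intervalIntegral.continuousOn_primitive_interval (a := 0) (b := T) (μ := volume)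
      (f := fun τ => f τ (Y τ) + E τ) (by rw [uIcc_of_le hT.le]; exact hfY.add hE)
    rw [uIcc_of_le hT.le] at h
    exact (continuousOn_const.add h).congr hY
  have hYF : ∀ t ∈ Icc 0 T, Y t = Y 0 + ∫ τ in (0 : ℝ)..t, (F τ (Y τ) + E τ) := fun t ht => by
    rw [hY t ht]
    congr 1
    refine intervalIntegral.integral_congr fun τ hτ => ?_
    rw [uIcc_of_le ht.1] at hτ
    rw [hproj τ ⟨hτ.1, hτ.2.trans ht.2⟩]
  refine ⟨⟨hflow.continuousOn_flow, fun s hs t ht x => (hflow.hasFDerivAt_flow hs ht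
    x).differentiableAt, hflow.continuousOn_fderiv_flow⟩, hflow.contDiffOn_flow, fun t ht => ?_,
    fun t ht => ?_, fun s hs t ht => hflow.alekseev_groebner hYc hE hYF hs.1 ht.1 ht.2⟩
  · have hD := (continuousOn_iff_continuous_domRestrict.1
      (hflow.continuousOn_fderiv_left ht.2 hYc)).stronglyMeasurable
    have hE' : StronglyMeasurable fun τ : Icc (0 : ℝ) t => E τ :=
      hE_meas.comp_measurable (measurable_inclusion (Icc_subset_Icc_right ht.2))
    exact (isBoundedBilinearMap_apply.continuous : Continuous fun p : (V →L[ℝ] V) × V =>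
      p.1 p.2).comp_stronglyMeasurable (hD.prodMk hE')
  · exact (hflow.continuousOn_fderiv_left ht.2 hYc).integrableOn_clm_apply
      (hE.mono_set (Icc_subset_Icc_right ht.2))
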